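/- **Theorem (CONGEST $\varepsilon$-tester for $T$-freeness).** There are absolute constants $C,B$ such that for every $\varepsilon>0$ there is a randomized distributed algorithm which, given a tree $T$ as common input to all processors, is a one-sided $\varepsilon$-tester for $T$-freeness in the $\mathsf{CONGEST}$ model, and which runs for at most $C\,k^{k^2+1}\varepsilon^{-k}$ rounds, where $k$ is the number of vertices of $T$; that is, its round complexity is $O(k^{k^2+1}\varepsilon^{-k})$. Here the network is an arbitrary finite simple graph $G=(V,E)$ with $n=|V|$. Each vertex is a processor that initially knows the common input, $n$, its own identifier (a natural number, distinct from those of the other processors), its number of incident links (which are numbered locally in an arbitrary order), and a private random element of a finite set (which may depend on the input and on $n$), drawn uniformly and independently of the other processors. In each synchronous round every processor performs an unrestricted local computation and sends to each of its neighbours a (possibly empty, possibly different) message of at most $B\log_2 n$ bits; after the last round every processor outputs ACCEPT or REJECT. A graph is $T$-free if it has no (not necessarily induced) subgraph isomorphic to $T$. A graph $G$ is $\varepsilon$-far from $T$-freeness if it is not $T$-free and every $T$-free graph $G'$ on the vertex set $V$ satisfies $|E(G)\,\triangle\, E(G')|\ge\varepsilon|E(G)|$. The algorithm is a one-sided $\varepsilon$-tester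 for $T$-freeness if, for every network $G$, every assignment of distinct identifiers and every local numbering of the links: (i) if $G$ is $T$-free, then all processors output ACCEPT, whatever the random choices; (ii) if $G$ is $\varepsilon$-far from $T$-freeness, then with probability at least $2/3$ at least one processor outputs REJECT. -/

import Mathlib

/-!
The distributed CONGEST model, testers in this model (in the general graph model), and
the inputs of a tester for tree-freeness.
-/

/-- The local output of a processor. -/
inductive Verdict where
  | accept
  | reject

/-- A finite network on the graph `G`. Every vertex is a processor and every edge is a
communication link. Processor `v` has an identifier `id v`, distinct from all others, and its
`deg v` incident links are attached to the local ports `0, …, deg v - 1` in an arbitrary order. -/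
structure Network {V : Type} (G : SimpleGraph V) where
  id : V → ℕ
  id_injective : Function.Injective id
  deg : V → ℕ
  port : (v : V) → Fin (deg v) ≃ G.neighborSet v

/-- A randomized synchronous message passing algorithm; all processors run the same program and
receive a common input of type `Input`. Local computation is unrestricted. Messages are bit
strings, `[]` being the empty message.

* `Coin x n` is the finite set from which each processor draws its private randomness, uniformly
  and independently of the other processors, on input `x` in a network with `n` processors.
* `init x n i d c` is the initial state of a processor with identifier `i`, `d` ports and private
  randomness `c`, on input `x` in a network with `n` processors.
* `send d s p` is the message which a processor in state `s` with `d` ports sends through port `p`.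
* `receive d s msg` is the new state of a processor in state `s` with `d` ports which receives the
  message `msg p` through port `p`, for every `p`.
* `rounds x n` is the number of rounds after which all processors stop.
* `output s` is the local output of a processor that stops in state `s`. -/
structure DistributedAlgorithm (Input : Type) where
  State : Type
  Coin : Input → ℕ → Type
  coin_finite : ∀ x n, Finite (Coin x n)
  coin_nonempty : ∀ x n, Nonempty (Coin x n)
  init : (x : Input) → (n i d : ℕ) → Coin x n → State
  send : (d : ℕ) → State → Fin d → List Bool
  receive : (d : ℕ) → State → (Fin d → List Bool) → State
  rounds : Input → ℕ → ℕ
  output : State → Verdict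

namespace DistributedAlgorithm

variable {Input : Type}

/-- The sample space of an execution: one independent private coin per processor. -/
abbrev Coins (A : DistributedAlgorithm Input) (x : Input) (V : Type) [Fintype V] : Type :=
  V → A.Coin x (Fintype.card V)

/-- The port of the `p`-th neighbour of `v` that leads back to `v`. -/
def backPort {V : Type} {G : SimpleGraph V} (N : Network G) (v : V) (p : Fin (N.deg v)) :
    Fin (N.deg (N.port v p)) :=
  (N.port (N.port v p)).symm ⟨v, (N.port v p).2.symm⟩

/-- The states of all processors after `t` rounds, when the coins are `ω`. In each round every
processor sends a message through each of its ports, and then receives the messages which its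
neighbours have sent to it. -/
def config (A : DistributedAlgorithm Input) (x : Input) {V : Type} [Fintype V]
    {G : SimpleGraph V} (N : Network G) (ω : A.Coins x V) : ℕ → V → A.State
  | 0 => fun v => A.init x (Fintype.card V) (N.id v) (N.deg v) (ω v)
  | t + 1 => fun v =>
      A.receive (N.deg v) (config A x N ω t v) fun p =>
        A.send (N.deg (N.port v p)) (config A x N ω t (N.port v p)) (backPort N v p)

/-- The local output of processor `v`. -/
def verdict (A : DistributedAlgorithm Input) (x : Input) {V : Type} [Fintype V]
    {G : SimpleGraph V} (N : Network G) (ω : A.Coins x V) (v : V) : Verdict :=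
  A.output (A.config x N ω (A.rounds x (Fintype.card V)) v)

/-- The probability of an event, over the independent uniform coins of the processors. -/
noncomputable def prob (A : DistributedAlgorithm Input) (x : Input) (V : Type) [Fintype V]
    (E : Set (A.Coins x V)) : ℝ :=
  (E.ncard : ℝ) / (Nat.card (A.Coins x V) : ℝ)

/-- On input `x`, in every execution on every network with `n` processors, every message has at
most `B * log₂ n` bits. -/
def CongestBound (A : DistributedAlgorithm Input) (x : Input) (B : ℝ) : Prop :=
  ∀ (V : Type) [Fintype V] (G : SimpleGraph V) (N : Network G) (ω : A.Coins x V) (t : ℕ),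
    t < A.rounds x (Fintype.card V) → ∀ (v : V) (p : Fin (N.deg v)),
      ((A.send (N.deg v) (A.config x N ω t v) p).length : ℝ)
        ≤ B * Real.logb 2 (Fintype.card V)

end DistributedAlgorithm

/-- A graph `G` is `ε`-far from the property `P` (general graph model) if it does not have `P` and
at least `ε * |E(G)|` edges must be added or removed in order to obtain `P`. The first clause
matters only when `G` has no edges. -/
def IsFar (P : (V : Type) → SimpleGraph V → Prop) (ε : ℝ) {V : Type} (G : SimpleGraph V) : Prop :=
  ¬ P V G ∧ ∀ G' : SimpleGraph V, P V G' →
    ε * (G.edgeSet.ncard : ℝ) ≤ ((symmDiff G.edgeSet G'.edgeSet).ncard : ℝ)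

/-- On input `x`, the algorithm `A` is a one-sided `ε`-tester for the graph property `P` in the
general graph model: if the network graph has `P`, then all processors always accept, and if it is
`ε`-far from `P`, then with probability at least `2 / 3` some processor rejects. -/
def IsTester {Input : Type} (A : DistributedAlgorithm Input) (x : Input) (ε : ℝ)
    (P : (V : Type) → SimpleGraph V → Prop) : Prop :=
  ∀ (V : Type) [Fintype V] (G : SimpleGraph V) (N : Network G),
    (P V G → ∀ (ω : A.Coins x V) (v : V), A.verdict x N ω v = Verdict.accept) ∧
    (IsFar P ε G →
      2 / 3 ≤ A.prob x V {ω | ∃ v, A.verdict x N ω v = Verdict.reject})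

/-- A graph on the labelled vertices `v_0, …, v_{k-1}`, given together with its order `k`. -/
abbrev GraphInput : Type := (k : ℕ) × SimpleGraph (Fin k)

/-! Colour coding finds a copy of `T` in every graph that contains one, so for `ε ≤ 1` farness is
used only through its first clause. Order the vertices of `T` so that each but the last has exactly
one later neighbour. In one repetition every processor draws a random vertex of `T` as its colour. A
processor of colour `i` sends a bit in slot `i` if it has heard from every earlier neighbour of `i`,
and it rejects if the last vertex is reached.

Soundness (`IsEliminationOrder.isContained`): tracing the bits back from a rejecting processor
places the vertices of `T` in reverse order. Each new vertex need only be joined to its single later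
neighbour, and distinct colours give injectivity.

Completeness: a fixed copy is coloured correctly with probability at least `k ^ (-k)`, and then it
is found (`exists_verdict_eq_reject`). Among `2 * k ^ k` repetitions this happens at least once with
probability at least `1 - exp (-2)`.

This costs `2 * k ^ (k + 1)` rounds, within the bound if `ε ≤ 1`. If `ε > 1`, zero rounds suffice: a
tree with an edge has no far graphs, and a single vertex is found without communication. -/

open SimpleGraph

/-! ### Elimination orders of trees -/

/-- The natural order of the vertices of `T` is an elimination order: every vertex but the last has
exactly one neighbour after it. -/
structure IsEliminationOrder {k : ℕ} (T : SimpleGraph (Fin k)) : Prop where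
  exists_gt : ∀ i : Fin k, (i : ℕ) + 1 < k → ∃ j, i < j ∧ T.Adj i j
  unique_gt : ∀ i j j' : Fin k, i < j → i < j' → T.Adj i j → T.Adj i j' → j = j'

theorem SimpleGraph.Connected.exists_adj_dist_lt {V : Type*} {G : SimpleGraph V}
    (hG : G.Connected) {u v : V} (h : u ≠ v) : ∃ w, G.Adj u w ∧ G.dist v w < G.dist v u := by
  obtain ⟨p, hp⟩ := hG.exists_walk_length_eq_dist u v
  cases p with
  | nil => exact absurd rfl h
  | cons hadj q =>
    refine ⟨_, hadj, ?_⟩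
    have := dist_le q
    rw [dist_comm (u := v), dist_comm (u := v), ← hp, Walk.length_cons]
    omega

/-- Sort the vertices by decreasing distance from a root. Every other vertex has a neighbour
strictly closer to the root, hence later in the order, and the root itself is last. -/
theorem SimpleGraph.Connected.exists_perm_exists_gt {k : ℕ} {T : SimpleGraph (Fin k)}
    (hT : T.Connected) :
    ∃ e : Equiv.Perm (Fin k), ∀ i : Fin k, (i : ℕ) + 1 < k → ∃ j, i < j ∧ T.Adj (e i) (e j) := by
  obtain ⟨root⟩ := hT.nonempty
  set f : Fin k → ℕᵒᵈ := fun v => OrderDual.toDual (T.dist root v) with hf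
  have hmono : ∀ i j, i ≤ j → T.dist root (Tuple.sort f j) ≤ T.dist root (Tuple.sort f i) :=
    fun i j hij => Tuple.monotone_sort f hij
  refine ⟨Tuple.sort f, fun i hi => ?_⟩
  have hlast : ∀ l : Fin k, (l : ℕ) + 1 = k → Tuple.sort f l = root := by
    intro l hl
    have h := hmono ((Tuple.sort f).symm root) l (Fin.le_def.2 (by omega))
    rw [Equiv.apply_symm_apply, dist_self, Nat.le_zero, hT.dist_eq_zero_iff] at h
    exact h.symm
  have hne : Tuple.sort f i ≠ root := by
    intro h
    rw [← hlast ⟨k - 1, by omega⟩ (by simp; omega)] at h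
    have := congrArg Fin.val ((Tuple.sort f).injective h)
    simp at this
    omega
  obtain ⟨w, hw, hlt⟩ := hT.exists_adj_dist_lt hne
  refine ⟨(Tuple.sort f).symm w, ?_, by simpa using hw⟩
  by_contra! h
  have := hmono _ _ h
  rw [Equiv.apply_symm_apply] at this
  omega

/-- A count of edges: choosing a later neighbour for each of the `k - 1` vertices before the last
gives distinct edges, and a tree has only `k - 1`, so no edge is left to provide a second later
neighbour. -/
theorem SimpleGraph.IsTree.isEliminationOrder {k : ℕ} {T : SimpleGraph (Fin k)} (hT : T.IsTree)
    (h : ∀ i : Fin k, (i : ℕ) + 1 < k → ∃ j, i < j ∧ T.Adj i j) : IsEliminationOrder T := by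
  classical
  refine ⟨h, ?_⟩
  choose! par hlt hadj using h
  set s : Finset (Fin k) := Finset.univ.filter fun i => (i : ℕ) + 1 < k with hs
  have hk : 0 < k := by
    obtain ⟨r⟩ := hT.connected.nonempty
    exact r.pos
  have hcard : s.card + 1 = k := by
    have : sᶜ = {⟨k - 1, by omega⟩} := by
      ext i
      simp only [hs, Finset.mem_compl, Finset.mem_filter, Finset.mem_univ, true_and,
        Finset.mem_singleton, Fin.ext_iff]
      omega
    have h' := Finset.card_add_card_compl s
    rw [this, Finset.card_singleton, Fintype.card_fin] at h'
    exact h'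
  have hE := hT.card_edgeFinset
  rw [Fintype.card_fin] at hE
  have key : ∀ a b i j : Fin k, a < b → i < j → s(a, b) = s(i, j) → a = i ∧ b = j := by
    intro a b i j hab hij heq
    rcases Sym2.eq_iff.1 heq with h | ⟨rfl, rfl⟩
    · exact h
    · exact absurd hab hij.asymm
  have hmem : ∀ i ∈ s, (i : ℕ) + 1 < k := fun i hi => (Finset.mem_filter.1 hi).2
  have hsurj := Finset.surjOn_of_injOn_of_card_le (s := s) (t := T.edgeFinset)
    (fun i => s(i, par i))
    (fun i hi => by simpa using hadj i (hmem i hi))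
    (fun i hi j hj hij => (key _ _ _ _ (hlt i (hmem i hi)) (hlt j (hmem j hj)) hij).1)
    (by omega)
  have huniq : ∀ i j, i < j → T.Adj i j → j = par i := by
    intro i j hij hA
    obtain ⟨a, ha, hae⟩ := hsurj (show s(i, j) ∈ (T.edgeFinset : Set (Sym2 (Fin k))) by simpa)
    obtain ⟨rfl, rfl⟩ := key _ _ _ _ (hlt a (hmem a ha)) hij hae
    rfl
  intro i j j' hj hj' hA hA'
  rw [huniq i j hj hA, huniq i j' hj' hA']

theorem SimpleGraph.IsTree.exists_perm_isEliminationOrder {k : ℕ} {T : SimpleGraph (Fin k)}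
    (hT : T.IsTree) : ∃ e : Equiv.Perm (Fin k), IsEliminationOrder (T.comap e) := by
  obtain ⟨e, he⟩ := hT.connected.exists_perm_exists_gt
  exact ⟨e, ((Iso.comap e T).isTree_iff.2 hT).isEliminationOrder he⟩

open Classical in
/-- `T` with its vertices renamed so that their natural order is an elimination order, if this is
possible. -/
noncomputable def eliminationRelabel {k : ℕ} (T : SimpleGraph (Fin k)) : SimpleGraph (Fin k) :=
  if h : ∃ e : Equiv.Perm (Fin k), IsEliminationOrder (T.comap e) then T.comap h.choose else T

theorem nonempty_eliminationRelabel_iso {k : ℕ} (T : SimpleGraph (Fin k)) :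
    Nonempty (eliminationRelabel T ≃g T) := by
  unfold eliminationRelabel
  split_ifs with h
  · exact ⟨Iso.comap h.choose T⟩
  · exact ⟨Iso.refl⟩

theorem SimpleGraph.IsTree.isEliminationOrder_eliminationRelabel {k : ℕ} {T : SimpleGraph (Fin k)}
    (hT : T.IsTree) : IsEliminationOrder (eliminationRelabel T) := by
  have h := hT.exists_perm_isEliminationOrder
  rw [eliminationRelabel, dif_pos h]
  exact h.choose_spec

/-- If `P i v` requires `v` to have colour `i` and, for every earlier neighbour `j` of `i`, a
neighbour which satisfies `P j`, then a vertex which satisfies `P` at the last vertex of `T` lies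
in a copy of `T`. -/
theorem IsEliminationOrder.isContained {k : ℕ} {T : SimpleGraph (Fin k)}
    (hT : IsEliminationOrder T) {V : Type*} {G : SimpleGraph V} (color : V → ℕ)
    (P : Fin k → V → Prop) (hcolor : ∀ i v, P i v → color v = i)
    (hchild : ∀ i v, P i v → ∀ j < i, T.Adj j i → ∃ w, G.Adj v w ∧ P j w)
    (l : Fin k) (hl : (l : ℕ) + 1 = k) (v : V) (hv : P l v) : T ⊑ G := by
  -- Induction on the number `m + 1` of vertices placed, counted from the last one; `φ` is arbitrary
  -- on the rest.
  have key : ∀ m < k, ∃ φ : Fin k → V, (∀ i : Fin k, k ≤ i + m + 1 → P i (φ i)) ∧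
      ∀ i j : Fin k, k ≤ i + m + 1 → i < j → T.Adj i j → G.Adj (φ i) (φ j) := by
    intro m
    induction m with
    | zero =>
      refine fun _ => ⟨fun _ => v, fun i hi => ?_, fun i j hi hij => ?_⟩
      · obtain rfl : i = l := Fin.ext (by omega)
        exact hv
      · exact absurd (Fin.lt_def.1 hij) (by omega)
    | succ m ih =>
      intro hm
      obtain ⟨φ, hP, hA⟩ := ih (by omega)
      let a : Fin k := ⟨k - (m + 2), by omega⟩
      have ha : (a : ℕ) + m + 2 = k := by simp only [a]; omega
      obtain ⟨b, hab, hadj⟩ := hT.exists_gt a (by omega)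
      have hab' := Fin.lt_def.1 hab
      obtain ⟨w, hw, hPw⟩ := hchild b (φ b) (hP b (by omega)) a hab hadj
      have hne : ∀ i : Fin k, k ≤ i + m + 1 → i ≠ a := by
        rintro i hi rfl
        omega
      have hcases : ∀ i : Fin k, k ≤ i + (m + 1) + 1 → i = a ∨ k ≤ i + m + 1 := by
        intro i hi
        by_cases h : k ≤ i + m + 1
        · exact Or.inr h
        · exact Or.inl (Fin.ext (by omega))
      refine ⟨Function.update φ a w, fun i hi => ?_, fun i j hi hij hTij => ?_⟩
      · rcases hcases i hi with rfl | h
        · rwa [Function.update_self]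
        · rw [Function.update_of_ne (hne i h)]
          exact hP i h
      · have hij' := Fin.lt_def.1 hij
        rw [Function.update_of_ne (hne j (by omega))]
        rcases hcases i hi with rfl | h
        · rw [Function.update_self, hT.unique_gt _ j b hij hab hTij hadj]
          exact hw.symm
        · rw [Function.update_of_ne (hne i h)]
          exact hA i j h hij hTij
  obtain ⟨φ, hP, hA⟩ := key (k - 1) (by omega)
  refine ⟨⟨⟨φ, fun {i j} hij => ?_⟩, fun i j hij => ?_⟩⟩
  · rcases lt_or_gt_of_ne hij.ne with h | h
    · exact hA i j (by omega) h hij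
    · exact (hA j i (by omega) h hij.symm).symm
  · have hi := hcolor i _ (hP i (by omega))
    have hj := hcolor j _ (hP j (by omega))
    have hij : φ i = φ j := hij
    rw [hij] at hi
    exact Fin.ext (hi.symm.trans hj)

/-! ### The algorithm -/

/-- The state of a processor: the graph searched for, the colours of the processor in the successive
repetitions, the number of rounds executed so far and the rounds in which a non-empty message was
received. -/
structure SearchState where
  order : ℕ
  graph : SimpleGraph (Fin order)
  color : ℕ → ℕ
  time : ℕ
  heard : Set ℕ

namespace SearchState

/-- In repetition `r` the processor has colour `i` and has heard from all colours which precede `i`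
and are adjacent to `i`. -/
def Complete (s : SearchState) (r : ℕ) (i : Fin s.order) : Prop :=
  s.color r = i ∧ ∀ j < i, s.graph.Adj j i → r * s.order + j ∈ s.heard

/-- The current round is slot `i` of a repetition in which the processor is complete at `i`. -/
def Active (s : SearchState) : Prop :=
  ∃ (r : ℕ) (i : Fin s.order), s.time = r * s.order + i ∧ s.Complete r i

/-- The processor is complete at the last vertex in one of the first `R` repetitions. -/
def Found (s : SearchState) (R : ℕ) : Prop :=
  ∃ r < R, ∃ i : Fin s.order, (i : ℕ) + 1 = s.order ∧ s.Complete r i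

end SearchState

/-- The number of repetitions for a tree with `k` vertices. -/
def repetitions (k : ℕ) : ℕ := 2 * k ^ k

open Classical in
/-- Search for a graph by colour coding. In every repetition each processor draws a colour, that is,
a vertex of the graph searched for. Slot `i` of a repetition is the round in which the processors
of colour `i` send one bit to all neighbours if they have heard from all earlier neighbours of `i`
in this repetition. -/
noncomputable def colorCodingSearch (rounds : ℕ → ℕ) : DistributedAlgorithm GraphInput where
  State := SearchState
  -- `x.1 - 1 + 1` is `x.1` unless the order is zero, when it keeps the coin set nonempty.
  Coin x _ := Fin (repetitions x.1) → Fin (x.1 - 1 + 1)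
  coin_finite _ _ := inferInstance
  coin_nonempty _ _ := inferInstance
  init x _ _ _ c :=
    { order := x.1
      graph := eliminationRelabel x.2
      color := fun r => if h : r < repetitions x.1 then c ⟨r, h⟩ else 0
      time := 0
      heard := ∅ }
  send _ s _ := if s.Active then [true] else []
  receive _ s msg :=
    { s with
      time := s.time + 1
      heard := s.heard ∪ {t | t = s.time ∧ ∃ p, msg p ≠ []} }
  rounds x _ := rounds x.1
  output s := if s.Found (repetitions s.order) then Verdict.reject else Verdict.accept

namespace colorCodingSearch

variable {rounds : ℕ → ℕ} {k : ℕ} {T : SimpleGraph (Fin k)} {V : Type} [Fintype V]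
  {G : SimpleGraph V}

/-- The colour of `v` in repetition `r`. -/
def color (ω : (colorCodingSearch rounds).Coins ⟨k, T⟩ V) (r : ℕ) (v : V) : ℕ :=
  if h : r < repetitions k then (ω v ⟨r, h⟩ : Fin (k - 1 + 1)) else 0

/-- `v` sends a bit in round `t`. -/
def SendsAt (N : Network G) (ω : (colorCodingSearch rounds).Coins ⟨k, T⟩ V) (t : ℕ) (v : V) :
    Prop :=
  ((colorCodingSearch rounds).config ⟨k, T⟩ N ω t v : SearchState).Active

open Classical in
theorem send_ne_nil_iff (d : ℕ) (s : SearchState) (p : Fin d) :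
    (colorCodingSearch rounds).send d s p ≠ [] ↔ s.Active := by
  change (if s.Active then [true] else []) ≠ [] ↔ s.Active
  split_ifs with h <;> simp [h]

open Classical in
theorem length_send_le (d : ℕ) (s : SearchState) (p : Fin d) :
    ((colorCodingSearch rounds).send d s p).length ≤ 1 := by
  change (if s.Active then [true] else []).length ≤ 1
  split_ifs <;> simp

/-- Closed form of the execution: only the set of rounds in which some neighbour sent a bit depends
on the communication. -/
theorem config_eq (N : Network G) (ω : (colorCodingSearch rounds).Coins ⟨k, T⟩ V) (t : ℕ) (v : V) :
    (colorCodingSearch rounds).config ⟨k, T⟩ N ω t v =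
      (⟨k, eliminationRelabel T, fun r => color ω r v, t,
        {s | s < t ∧ ∃ w, G.Adj v w ∧ SendsAt N ω s w}⟩ : SearchState) := by
  induction t with
  | zero =>
    change SearchState.mk _ _ _ _ _ = _
    congr
    ext
    simp
  | succ t ih =>
    change SearchState.mk _ _ _ _ _ = _
    rw [ih]
    congr 1
    ext s
    have hport : (∃ p : Fin (N.deg v), SendsAt N ω t (N.port v p)) ↔
        ∃ w, G.Adj v w ∧ SendsAt N ω t w := by
      constructor
      · rintro ⟨p, hp⟩
        exact ⟨_, (N.port v p).2, hp⟩
      · rintro ⟨w, hw, hs⟩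
        refine ⟨(N.port v).symm ⟨w, hw⟩, ?_⟩
        rwa [Equiv.apply_symm_apply]
    have hmsg : (∃ p : Fin (N.deg v), (colorCodingSearch rounds).send (N.deg (N.port v p))
        ((colorCodingSearch rounds).config ⟨k, T⟩ N ω t (N.port v p))
        (DistributedAlgorithm.backPort N v p) ≠ []) ↔ ∃ w, G.Adj v w ∧ SendsAt N ω t w :=
      (exists_congr fun p => send_ne_nil_iff _ _ _).trans hport
    change (s < t ∧ ∃ w, G.Adj v w ∧ SendsAt N ω s w) ∨ (s = t ∧ ∃ p : Fin (N.deg v), _) ↔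
      s < t + 1 ∧ ∃ w, G.Adj v w ∧ SendsAt N ω s w
    rw [hmsg]
    constructor
    · rintro (⟨h, h'⟩ | ⟨rfl, h'⟩)
      · exact ⟨by omega, h'⟩
      · exact ⟨by omega, h'⟩
    · rintro ⟨h, h'⟩
      rcases Nat.lt_succ_iff_lt_or_eq.1 h with h | rfl
      · exact Or.inl ⟨h, h'⟩
      · exact Or.inr ⟨rfl, h'⟩

/-- Division by `k` recovers repetition and slot from the round number, and slots `j < i` of the
same repetition are already over. This turns the execution into a recursion on colours. -/
theorem sendsAt_iff (N : Network G) (ω : (colorCodingSearch rounds).Coins ⟨k, T⟩ V) (r : ℕ)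
    (i : Fin k) (v : V) :
    SendsAt N ω (r * k + i) v ↔ color ω r v = i ∧
      ∀ j < i, (eliminationRelabel T).Adj j i → ∃ w, G.Adj v w ∧ SendsAt N ω (r * k + j) w := by
  rw [SendsAt, config_eq]
  constructor
  · rintro ⟨r', i', h, hc, hj⟩
    have hk := i.pos
    change r * k + i = r' * k + i' at h
    have hi : (i : ℕ) = i' := by
      have := congrArg (· % k) h
      simpa [Nat.mod_eq_of_lt i.2, Nat.mod_eq_of_lt i'.2] using this
    obtain rfl : i = i' := Fin.ext hi
    obtain rfl : r = r' := Nat.eq_of_mul_eq_mul_right hk (by omega)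
    exact ⟨hc, fun j hji hadj => (hj j hji hadj).2⟩
  · rintro ⟨hc, hj⟩
    exact ⟨r, i, rfl, hc, fun j hji hadj => ⟨by simpa using hji, hj j hji hadj⟩⟩

open Classical in
theorem verdict_eq_reject_iff (N : Network G) (ω : (colorCodingSearch rounds).Coins ⟨k, T⟩ V)
    (v : V) :
    (colorCodingSearch rounds).verdict ⟨k, T⟩ N ω v = Verdict.reject ↔
      ∃ r < repetitions k, ∃ i : Fin k, (i : ℕ) + 1 = k ∧ color ω r v = i ∧
        ∀ j < i, (eliminationRelabel T).Adj j i →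
          r * k + j < rounds k ∧ ∃ w, G.Adj v w ∧ SendsAt N ω (r * k + j) w := by
  rw [DistributedAlgorithm.verdict, config_eq]
  change (if _ then Verdict.reject else Verdict.accept) = _ ↔ _
  rw [ite_eq_left_iff]
  simp only [reduceCtorEq, imp_false, not_not]
  rfl

/-- Processors reject only if the graph contains a copy of the tree. -/
theorem isContained_of_verdict_eq_reject (hT : T.IsTree) (N : Network G)
    (ω : (colorCodingSearch rounds).Coins ⟨k, T⟩ V) (v : V)
    (h : (colorCodingSearch rounds).verdict ⟨k, T⟩ N ω v = Verdict.reject) : T ⊑ G := by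
  obtain ⟨r, -, l, hl, hc, hj⟩ := (verdict_eq_reject_iff N ω v).1 h
  obtain ⟨e⟩ := nonempty_eliminationRelabel_iso T
  refine (isContained_congr_left e).1 (hT.isEliminationOrder_eliminationRelabel.isContained
    (color ω r) (fun i v => color ω r v = i ∧ ∀ j < i, (eliminationRelabel T).Adj j i →
      ∃ w, G.Adj v w ∧ SendsAt N ω (r * k + j) w) (fun i v h => h.1) ?_ l hl v
    ⟨hc, fun j hji hadj => (hj j hji hadj).2⟩)
  rintro i v ⟨-, h⟩ j hji hadj
  obtain ⟨w, hw, hs⟩ := h j hji hadj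
  exact ⟨w, hw, (sendsAt_iff N ω r j w).1 hs⟩

/-- A copy of the tree whose vertices have the right colours in some repetition is found. -/
theorem exists_verdict_eq_reject (hk : 0 < k) (hrounds : k = 1 ∨ repetitions k * k ≤ rounds k)
    (N : Network G) (ω : (colorCodingSearch rounds).Coins ⟨k, T⟩ V)
    (f : Copy (eliminationRelabel T) G) {r : ℕ} (hr : r < repetitions k)
    (hf : ∀ i : Fin k, color ω r (f i) = i) :
    ∃ v, (colorCodingSearch rounds).verdict ⟨k, T⟩ N ω v = Verdict.reject := by
  have hsend : ∀ i : Fin k, SendsAt N ω (r * k + i) (f i) := by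
    intro i
    -- The earlier neighbours of `i` have their own colours and, by induction, have sent in their
    -- slots.
    induction i using WellFoundedLT.induction with
    | _ i ih =>
      exact (sendsAt_iff N ω r i _).2
        ⟨hf i, fun j hji hadj => ⟨f j, f.toHom.map_rel hadj.symm, ih j hji⟩⟩
  let l : Fin k := ⟨k - 1, by omega⟩
  have hl : (l : ℕ) + 1 = k := by simp only [l]; omega
  refine ⟨f l, (verdict_eq_reject_iff N ω _).2 ⟨r, hr, l, hl, hf l, fun j hji hadj =>
    ⟨?_, f j, f.toHom.map_rel hadj.symm, hsend j⟩⟩⟩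
  have hji := Fin.lt_def.1 hji
  rcases hrounds with rfl | h
  -- For `k = 1` there is no earlier `j`, so no round is needed.
  · omega
  · have : (r + 1) * k ≤ repetitions k * k := Nat.mul_le_mul_right k hr
    have hj := j.2
    rw [Nat.succ_mul] at this
    omega

end colorCodingSearch

/-! ### The probability of a proper colouring -/

/-- A uniform colouring extends a given injective partial colouring by `K` colours of `k` vertices
with probability at least `K ^ (-k)`. -/
theorem card_le_pow_mul_card_extending {V : Type} [Fintype V] {k K : ℕ} (f : Fin k ↪ V)
    (g : Fin k → Fin K) :
    Nat.card (V → Fin K) ≤ K ^ k * Nat.card {c : V → Fin K // ∀ i, c (f i) = g i} := by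
  have : K ^ k * Nat.card {c : V → Fin K // ∀ i, c (f i) = g i} =
      Nat.card ((Fin k → Fin K) × {c : V → Fin K // ∀ i, c (f i) = g i}) := by
    rw [Nat.card_prod]
    simp
  rw [this]
  -- A colouring is recovered from its values on the range of `f` together with the colouring
  -- overwritten there by `g`.
  refine Nat.card_le_card_of_injective
    (fun c => (fun i => c (f i), ⟨Function.extend f g c, fun i => f.injective.extend_apply g c i⟩))
    fun c c' h => ?_
  simp only [Prod.mk.injEq, Subtype.mk.injEq] at h
  funext v
  by_cases hv : ∃ i, f i = v
  · obtain ⟨i, rfl⟩ := hv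
    exact congrFun h.1 i
  · have := congrFun h.2 v
    rwa [Function.extend_apply' _ _ _ hv, Function.extend_apply' _ _ _ hv] at this

/-- If a property of one element has probability at least `1 / q`, then it holds for some of
`2 * q` independent elements with probability at least `2 / 3`. -/
theorem two_thirds_le_card_exists_div {α : Type*} [Finite α] [Nonempty α] {q : ℕ} (hq : 0 < q)
    (P : α → Prop) (h : Nat.card α ≤ q * Nat.card {a // P a}) :
    2 / 3 ≤ (Nat.card {c : Fin (2 * q) → α // ∃ r, P (c r)} : ℝ) /
      Nat.card (Fin (2 * q) → α) := by
  classical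
  have := Fintype.ofFinite α
  have hM : (0 : ℝ) < Nat.card α := by exact_mod_cast Nat.card_pos
  have hbad : Nat.card {c : Fin (2 * q) → α // ¬ ∃ r, P (c r)} =
      Nat.card {a // ¬ P a} ^ (2 * q) := by
    have e : {c : Fin (2 * q) → α // ¬ ∃ r, P (c r)} ≃ (Fin (2 * q) → {a // ¬ P a}) :=
      (Equiv.subtypeEquivRight fun c => not_exists).trans
        (Equiv.subtypePiEquivPi (p := fun _ a => ¬ P a))
    rw [Nat.card_congr e]
    simp
  have hsum : ∀ {β : Type _} [Finite β] (Q : β → Prop),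
      Nat.card {b // Q b} + Nat.card {b // ¬ Q b} = Nat.card β := by
    intro β _ Q
    rw [← Nat.card_sum]
    exact Nat.card_congr (Equiv.sumCompl Q)
  have h1 : (Nat.card {c : Fin (2 * q) → α // ∃ r, P (c r)} : ℝ) =
      (Nat.card α : ℝ) ^ (2 * q) - (Nat.card {a // ¬ P a} : ℝ) ^ (2 * q) := by
    have := hsum fun c : Fin (2 * q) → α => ∃ r, P (c r)
    rw [hbad, Nat.card_fun, Nat.card_fin] at this
    rw [eq_sub_iff_add_eq]
    exact_mod_cast this
  have hq' : (0 : ℝ) < q := by exact_mod_cast hq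
  have h2 : (Nat.card {a // ¬ P a} : ℝ) / Nat.card α ≤ 1 - 1 / q := by
    have h3 : (Nat.card {a // P a} : ℝ) + Nat.card {a // ¬ P a} = Nat.card α := by
      exact_mod_cast hsum P
    have h4 : (Nat.card α : ℝ) ≤ q * Nat.card {a // P a} := by exact_mod_cast h
    rw [div_le_iff₀ hM, sub_mul, one_mul, one_div, ← h3]
    have : (q : ℝ)⁻¹ * (Nat.card {a // P a} + Nat.card {a // ¬ P a}) ≤ Nat.card {a // P a} := by
      rw [h3, inv_mul_le_iff₀ hq']
      exact h4
    linarith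
  -- `(1 - 1 / q) ^ (2 * q) ≤ exp (-2) ≤ 1 / 3`, where `exp 2 ≥ 3` comes from `1 + x ≤ exp x`.
  have h5 : ((Nat.card {a // ¬ P a} : ℝ) / Nat.card α) ^ (2 * q) ≤ 1 / 3 := by
    have h6 : 1 - 1 / (q : ℝ) ≤ Real.exp (-(1 / q)) := by
      have := Real.add_one_le_exp (-(1 / (q : ℝ)))
      linarith
    calc ((Nat.card {a // ¬ P a} : ℝ) / Nat.card α) ^ (2 * q)
        ≤ Real.exp (-(1 / q)) ^ (2 * q) := by
          gcongr
          exact h2.trans h6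
      _ = (Real.exp 2)⁻¹ := by
          rw [← Real.exp_nat_mul, ← Real.exp_neg]
          congr 1
          push_cast
          field_simp
      _ ≤ 1 / 3 := by
          rw [one_div]
          have := Real.add_one_le_exp (2 : ℝ)
          exact inv_anti₀ (by norm_num) (by linarith)
  rw [h1, Nat.card_fun, Nat.card_fin, Nat.cast_pow, sub_div, div_self (by positivity), ← div_pow]
  linarith

/-! ### Success probability and message length of the search -/

namespace colorCodingSearch

variable {rounds : ℕ → ℕ} {k : ℕ} {T : SimpleGraph (Fin k)} {V : Type} [Fintype V]
  {G : SimpleGraph V}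

/-- If the graph contains a copy of the tree, then it is found with probability at least `2 / 3`. -/
theorem two_thirds_le_prob (hk : 0 < k) (hrounds : k = 1 ∨ repetitions k * k ≤ rounds k)
    (N : Network G) (h : T ⊑ G) :
    2 / 3 ≤ (colorCodingSearch rounds).prob ⟨k, T⟩ V
      {ω | ∃ v, (colorCodingSearch rounds).verdict ⟨k, T⟩ N ω v = Verdict.reject} := by
  obtain ⟨e⟩ := nonempty_eliminationRelabel_iso T
  obtain ⟨f⟩ := (isContained_congr_left e).2 h
  have hk1 : k - 1 + 1 = k := by omega
  let P : (V → Fin (k - 1 + 1)) → Prop := fun c => ∀ i : Fin k, c (f i) = Fin.cast hk1.symm i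
  have hP : Nat.card (V → Fin (k - 1 + 1)) ≤ k ^ k * Nat.card {c // P c} := by
    have := card_le_pow_mul_card_extending (K := k - 1 + 1) f.toEmbedding (Fin.cast hk1.symm)
    calc _ ≤ _ := this
      _ = _ := congrArg (fun m => m ^ k * _) hk1
  refine (two_thirds_le_card_exists_div (pow_pos hk k) P hP).trans ?_
  -- Indexing the coins by repetition instead of by processor exhibits the repetitions as
  -- independent uniform colourings of `V`.
  let swap : (Fin (repetitions k) → V → Fin (k - 1 + 1)) ≃
      (colorCodingSearch rounds).Coins ⟨k, T⟩ V := Equiv.piComm _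
  rw [DistributedAlgorithm.prob, ← Nat.card_congr swap, ← Nat.card_coe_set_eq]
  refine div_le_div_of_nonneg_right (Nat.cast_le.2 ?_) (Nat.cast_nonneg _)
  have : Finite ((colorCodingSearch rounds).Coins ⟨k, T⟩ V) := Finite.of_equiv _ swap
  refine Nat.card_le_card_of_injective (fun c => ⟨swap c.1, ?_⟩) fun c c' hc => ?_
  · obtain ⟨r, hr⟩ := c.2
    refine exists_verdict_eq_reject hk hrounds N (swap c.1) f r.2 fun i => ?_
    exact (dif_pos r.2).trans (congrArg Fin.val (hr i))
  · exact Subtype.ext (swap.injective (congrArg Subtype.val hc))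

/-- A message has at most one bit, and a processor with a port has a neighbour, so `n ≥ 2` and `log₂
n ≥ 1`. -/
theorem congestBound : (colorCodingSearch rounds).CongestBound ⟨k, T⟩ 1 := by
  intro V _ G N ω t _ v p
  have : Nontrivial V := ⟨v, N.port v p, (N.port v p).2.ne⟩
  have hn : (2 : ℝ) ≤ Fintype.card V := by exact_mod_cast Fintype.one_lt_card (α := V)
  have hlog : 1 ≤ Real.logb 2 (Fintype.card V) := by
    rw [Real.le_logb_iff_rpow_le (by norm_num) (by linarith), Real.rpow_one]
    exact hn
  rw [one_mul]
  exact le_trans (by exact_mod_cast length_send_le _ _ p) hlog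

end colorCodingSearch

/-! ### The case of large `ε` and the main theorem -/

/-- For `ε > 1` no graph is `ε`-far from freeness of a tree with an edge. -/
theorem SimpleGraph.IsTree.not_isFar_of_one_lt {k : ℕ} {T : SimpleGraph (Fin k)} (hT : T.IsTree)
    (hk : k ≠ 1) {ε : ℝ} (hε : 1 < ε) {V : Type} [Finite V] (G : SimpleGraph V) :
    ¬ IsFar (fun _ G => T.Free G) ε G := by
  rintro ⟨hG, hfar⟩
  have hbot : T ≠ ⊥ := by
    rintro rfl
    have hk0 : 0 < k := hT.connected.nonempty.elim fun i => i.pos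
    have : Nontrivial (Fin k) := Fin.nontrivial_iff_two_le.2 (by omega)
    exact not_preconnected_bot hT.connected.preconnected
  -- Deleting all edges gives `ε * |E(G)| ≤ |E(G)|`, so `G` has no edges and is itself free of `T`.
  have h := hfar ⊥ (free_bot hbot)
  rw [edgeSet_bot, ← Set.bot_eq_empty, symmDiff_bot] at h
  have h0 : (G.edgeSet.ncard : ℝ) = 0 := by
    have : (0 : ℝ) ≤ G.edgeSet.ncard := Nat.cast_nonneg _
    nlinarith
  rw [Nat.cast_eq_zero, Set.ncard_eq_zero, edgeSet_eq_empty] at h0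
  exact hG (h0 ▸ free_bot hbot)

theorem mainTheorem8 :
    ∃ C B : ℝ, ∀ ε : ℝ, 0 < ε →
      ∃ A : DistributedAlgorithm GraphInput,
        ∀ (k : ℕ) (T : SimpleGraph (Fin k)), T.IsTree →
          IsTester A ⟨k, T⟩ ε (fun _ G => T.Free G) ∧
          A.CongestBound ⟨k, T⟩ B ∧
          ∀ n : ℕ, (A.rounds ⟨k, T⟩ n : ℝ) ≤ C * (k : ℝ) ^ (k ^ 2 + 1) * ε⁻¹ ^ k := by
  classical
  -- For `ε > 1` the factor `ε⁻¹ ^ k` can make the allowed number of rounds less than one, hence the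
  -- zero.
  refine ⟨2, 1, fun ε hε => ⟨colorCodingSearch fun k => if ε ≤ 1 then repetitions k * k else 0,
    fun k T hT => ⟨fun V _ G N => ⟨fun hfree ω v => ?_, fun hfar => ?_⟩,
      colorCodingSearch.congestBound, fun n => ?_⟩⟩⟩
  · cases h : DistributedAlgorithm.verdict _ _ N ω v with
    | accept => rfl
    | reject => exact absurd (colorCodingSearch.isContained_of_verdict_eq_reject hT N ω v h) hfree
  · have hk : 0 < k := hT.connected.nonempty.elim fun i => i.pos
    refine colorCodingSearch.two_thirds_le_prob hk ?_ N (not_not.1 hfar.1)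
    by_cases h1 : ε ≤ 1
    · exact Or.inr (by rw [if_pos h1])
    · by_contra! hne
      exact hT.not_isFar_of_one_lt hne.1 (not_le.1 h1) G hfar
  · have hk : 0 < k := hT.connected.nonempty.elim fun i => i.pos
    change (((if ε ≤ 1 then repetitions k * k else 0 : ℕ)) : ℝ) ≤ _
    split_ifs with h1
    · have hk1 : (1 : ℝ) ≤ k := by exact_mod_cast hk
      have hε1 : (1 : ℝ) ≤ ε⁻¹ ^ k := one_le_pow₀ ((one_le_inv₀ hε).2 h1)
      calc ((repetitions k * k : ℕ) : ℝ) = 2 * (k : ℝ) ^ (k + 1) := by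
            rw [repetitions]
            push_cast
            ring
        _ ≤ 2 * (k : ℝ) ^ (k ^ 2 + 1) := by
            gcongr
            exact Nat.le_self_pow (by norm_num) k
        _ ≤ 2 * (k : ℝ) ^ (k ^ 2 + 1) * ε⁻¹ ^ k := le_mul_of_one_le_right (by positivity) hε1
    · rw [Nat.cast_zero]
      positivity
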